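/- Let $\mathcal X$ be a separable Banach space with a Borel probability measure $\mu_0$ (the prior), let $\mathcal D$ be a metric space, $p\in\mathbb N$, and let $\Gamma\in\mathbb R^{p\times p}$ be symmetric positive definite; write $\|v\|_\Gamma=\|\Gamma^{-1/2}v\|$ for $v\in\mathbb R^p$, with $\|\cdot\|$ the Euclidean norm. Let $\mathcal G,\mathcal G_N:\mathcal X\times\mathcal D\to\mathbb R^p$ ($N\in\mathbb N$) be maps that are Borel measurable in $x$ for every fixed $d$. Consider the model $y=\mathcal G(x;d)+\epsilon$ with $\epsilon\sim\mathcal N(0,\Gamma)$, whose likelihood is the Gaussian density $$\pi(y|x;d)=\frac{1}{\sqrt{(2\pi)^p\det\Gamma}}\exp\Big(-\tfrac12\|y-\mathcal G(x;d)\|_\Gamma^2\Big),$$ with evidence $\pi(y;d)=\int_{\mathcal X}\pi(y|x;d)\,d\mu_0(x)$, and the expected utility (expected information gain) $$U(d)=\int_{\mathbb R^p}\int_{\mathcal X}\log\Big(\frac{\pi(y|x;d)}{\pi(y;d)}\Big)\,\pi(y|x;d)\,d\mu_0(x)\,dy .$$ Let $U_N$ be defined in the same way with $\mathcal G_N$ in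 place of $\mathcal G$. Assume: 1. there is a constant $C_G$ such that $\sup_{d\in\mathcal D}\int_{\mathcal X}\|\mathcal G(x;d)\|_\Gamma^4\,d\mu_0(x)\le C_G$ and $\sup_{d\in\mathcal D}\int_{\mathcal X}\|\mathcal G_N(x;d)\|_\Gamma^4\,d\mu_0(x)\le C_G$ for all $N$; 2. there are a constant $C_0$ and a function $\psi:\mathbb N\to[0,\infty)$ with $\psi(N)\to0$ as $N\to\infty$ such that $\int_{\mathcal X}\|\mathcal G(x;d)-\mathcal G_N(x;d)\|_\Gamma^2\,d\mu_0(x)\le C_0\,\psi(N)$ for all $N$ and all $d\in\mathcal D$; 3. for every $x\in\mathcal X$ the map $d\mapsto\mathcal G(x;d)$ is continuous on $\mathcal D$. Then the double integrals defining $U(d)$ and $U_N(d)$ converge absolutely for all $d$ and $N$, and there is a constant $C>0$ such that for all sufficiently large $N$ $$\sup_{d\in\mathcal D}|U(d)-U_N(d)|\le C\sqrt{\psi(N)} .$$ Moreover, if $d_N^*\in\mathcal D$ is a maximizer of $U_N$ over $\mathcal D$ for every $N$, then the limit in $\mathcal D$ of any convergent subsequence of $(d_N^*)$ is a maximizer of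 $U$ over $\mathcal D$. -/

import Mathlib

open MeasureTheory Filter
open scoped Topology MatrixOrder ENNReal

namespace BayesOED

noncomputable section

/-- The weighted norm `‖v‖_Γ = ‖Γ^{-1/2} v‖` on `ℝ^p`, with the Euclidean norm on the right. -/
def weightedNorm {p : ℕ} (Γ : Matrix (Fin p) (Fin p) ℝ) (v : EuclideanSpace ℝ (Fin p)) : ℝ :=
  ‖Matrix.toEuclideanCLM (𝕜 := ℝ) (CFC.sqrt Γ)⁻¹ v‖

/-- The Lebesgue density at `y` of the Gaussian distribution `N(m, Γ)` on `ℝ^p`. -/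
def gaussianDensity {p : ℕ} (Γ : Matrix (Fin p) (Fin p) ℝ) (m y : EuclideanSpace ℝ (Fin p)) : ℝ :=
  (√((2 * Real.pi) ^ p * Γ.det))⁻¹ * Real.exp (-(1 / 2) * weightedNorm Γ (y - m) ^ 2)

/-- The likelihood `π(y | x)` of the model `y = g(x) + ε` with noise `ε ∼ N(0, Γ)`. -/
def likelihood {X : Type*} {p : ℕ} (Γ : Matrix (Fin p) (Fin p) ℝ)
    (g : X → EuclideanSpace ℝ (Fin p)) (x : X) (y : EuclideanSpace ℝ (Fin p)) : ℝ :=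
  gaussianDensity Γ (g x) y

/-- The evidence `π(y) = ∫ π(y | x) dμ₀(x)` of a likelihood `π` under the prior `μ₀`. -/
def evidence {X Y : Type*} [MeasurableSpace X] (μ₀ : Measure X) (π : X → Y → ℝ) (y : Y) : ℝ :=
  ∫ x, π x y ∂μ₀

/-- The integrand `log (π(y | x) / π(y)) π(y | x)` of the expected information gain. -/
def utilityIntegrand {X Y : Type*} [MeasurableSpace X] (μ₀ : Measure X) (π : X → Y → ℝ)
    (y : Y) (x : X) : ℝ :=
  Real.log (π x y / evidence μ₀ π y) * π x y

/-- The expected utility (expected information gain)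
`∫_Y ∫_X log (π(y | x) / π(y)) π(y | x) dμ₀(x) dy`. -/
def expectedUtility {X Y : Type*} [MeasurableSpace X] [MeasureSpace Y] (μ₀ : Measure X)
    (π : X → Y → ℝ) : ℝ :=
  ∫ y, ∫ x, utilityIntegrand μ₀ π y x ∂μ₀

/-- The double integral that defines the expected utility converges absolutely, so that the
expected utility is a genuine finite number. -/
def FiniteUtility {X Y : Type*} [MeasurableSpace X] [MeasureSpace Y] (μ₀ : Measure X)
    (π : X → Y → ℝ) : Prop :=
  Integrable (fun z : Y × X => utilityIntegrand μ₀ π z.1 z.2) ((volume : Measure Y).prod μ₀)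

/-- The expected utility of the design `d` in the model `y = G(x; d) + ε`, `ε ∼ N(0, Γ)`, with
prior `μ₀`. -/
def designUtility {X D : Type*} [MeasurableSpace X] {p : ℕ} (μ₀ : Measure X)
    (Γ : Matrix (Fin p) (Fin p) ℝ) (G : X → D → EuclideanSpace ℝ (Fin p)) (d : D) : ℝ :=
  expectedUtility μ₀ (likelihood Γ fun x => G x d)

end

end BayesOED

/-! Write `k` for the noise density, `ρ_g` for the evidence of a forward map `g`, and `A`, `B` for
the integrals of `k` and `‖L v‖² k(v)`; only their finiteness matters. Substituting `y = v + g x`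
gives `U(g) = ∫ k log k - ∫∫ log ρ_g(v + g x) k(v) dv dμ`, and the first term does not depend on
`g`.

For two forward maps, Gibbs' inequality allows `ρ_h(v + h x)` to be replaced by `ρ_g(v + h x)`, so
`U(h) - U(g)` is at most the mean of `log ρ_g(v + g x) - log ρ_g(v + h x)`: one log-evidence at two
points that differ by `δ = g x - h x`. Jensen's inequality under the posterior bounds this by `(1 +
1/t)/2 ‖Lδ‖²` plus `t/2` times the posterior mean of the squared residual
(`log_kernelEvidence_sub_le`), and the latter averages to `B`. Taking `t` equal to a bound `s ≤ 1`
on the `L²` distance of `g` and `h` yields `|U(g) - U(h)| ≤ (A + B) s`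
(`abs_expectedUtility_sub_le`).

This is the rate. With Vitali's theorem it also makes `U` sequentially continuous in `d`, and
uniform approximation plus continuity passes maximizers to the limit. -/

namespace BayesOED

noncomputable section

/-! ### Gaussian mixtures at a fixed data point -/

variable {X E : Type*} [MeasurableSpace X] {μ : Measure X} [NormedAddCommGroup E] [NormedSpace ℝ E]

/-- The unnormalized Gaussian kernel `v ↦ c exp (-‖L v‖² / 2)`. -/
def gaussianKernel (c : ℝ) (L : E →L[ℝ] E) (v : E) : ℝ :=
  c * Real.exp (-(1 / 2) * ‖L v‖ ^ 2)

/-- The likelihood of the model `y = g(x) + ε` whose noise has density `gaussianKernel c L`. -/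
def kernelLikelihood (c : ℝ) (L : E →L[ℝ] E) (g : X → E) (x : X) (y : E) : ℝ :=
  gaussianKernel c L (y - g x)

/-- The evidence of `kernelLikelihood c L g`: the mixture of the kernels centred at `g x`. -/
def kernelEvidence (μ : Measure X) (c : ℝ) (L : E →L[ℝ] E) (g : X → E) (y : E) : ℝ :=
  ∫ x, gaussianKernel c L (y - g x) ∂μ

/-- The mixture of the kernels centred at `g x`, weighted by the squared residual. -/
def residualEvidence (μ : Measure X) (c : ℝ) (L : E →L[ℝ] E) (g : X → E) (y : E) : ℝ :=
  ∫ x, ‖L (y - g x)‖ ^ 2 * gaussianKernel c L (y - g x) ∂μ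

variable {c : ℝ} {L : E →L[ℝ] E} {g h : X → E}

lemma gaussianKernel_pos (hc : 0 < c) (v : E) : 0 < gaussianKernel c L v := by
  unfold gaussianKernel; positivity

lemma gaussianKernel_le (hc : 0 < c) (v : E) : gaussianKernel c L v ≤ c := by
  unfold gaussianKernel
  refine mul_le_of_le_one_right hc.le (Real.exp_le_one_iff.2 ?_)
  nlinarith [sq_nonneg ‖L v‖]

lemma continuous_gaussianKernel : Continuous (gaussianKernel c L) := by
  unfold gaussianKernel; fun_prop

/-- Half of the exponent absorbs the quadratic factor, by `u + 1 ≤ exp u`; the other half is left to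
be integrated over `v`. -/
lemma sq_norm_mul_gaussianKernel_le_exp (hc : 0 < c) (v : E) :
    ‖L v‖ ^ 2 * gaussianKernel c L v ≤ 4 * c * Real.exp (-(1 / 4) * ‖L v‖ ^ 2) := by
  have h1 : ‖L v‖ ^ 2 ≤ 4 * Real.exp (1 / 4 * ‖L v‖ ^ 2) := by
    nlinarith [Real.add_one_le_exp (1 / 4 * ‖L v‖ ^ 2)]
  calc ‖L v‖ ^ 2 * gaussianKernel c L v
      ≤ 4 * Real.exp (1 / 4 * ‖L v‖ ^ 2) * gaussianKernel c L v :=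
        mul_le_mul_of_nonneg_right h1 (gaussianKernel_pos hc v).le
    _ = 4 * c * (Real.exp (1 / 4 * ‖L v‖ ^ 2) * Real.exp (-(1 / 2) * ‖L v‖ ^ 2)) := by
        unfold gaussianKernel; ring
    _ = _ := by rw [← Real.exp_add]; ring_nf

lemma sq_norm_mul_gaussianKernel_le (hc : 0 < c) (v : E) :
    ‖L v‖ ^ 2 * gaussianKernel c L v ≤ 4 * c := by
  refine (sq_norm_mul_gaussianKernel_le_exp hc v).trans ?_
  refine mul_le_of_le_one_right (by positivity) (Real.exp_le_one_iff.2 ?_)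
  nlinarith [sq_nonneg ‖L v‖]

variable [MeasurableSpace E] [BorelSpace E]

section FixedData

variable [IsProbabilityMeasure μ]

lemma integrable_gaussianKernel_sub (hc : 0 < c) (hg : Measurable g) (y : E) :
    Integrable (fun x => gaussianKernel c L (y - g x)) μ := by
  refine Integrable.of_bound
    (continuous_gaussianKernel.measurable.comp (hg.const_sub y)).aestronglyMeasurable c
    (ae_of_all _ fun x => ?_)
  rw [Real.norm_of_nonneg (gaussianKernel_pos hc _).le]
  exact gaussianKernel_le hc _

lemma integrable_sq_mul_gaussianKernel_sub (hc : 0 < c) (hg : Measurable g) (y : E) :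
    Integrable (fun x => ‖L (y - g x)‖ ^ 2 * gaussianKernel c L (y - g x)) μ := by
  have hm : Measurable fun v => ‖L v‖ ^ 2 * gaussianKernel c L v :=
    (((L.continuous.norm).pow 2).mul continuous_gaussianKernel).measurable
  refine Integrable.of_bound (hm.comp (hg.const_sub y)).aestronglyMeasurable (4 * c)
    (ae_of_all _ fun x => ?_)
  rw [Real.norm_of_nonneg (mul_nonneg (by positivity) (gaussianKernel_pos hc _).le)]
  exact sq_norm_mul_gaussianKernel_le hc _

lemma kernelEvidence_pos (hc : 0 < c) (hg : Measurable g) (y : E) :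
    0 < kernelEvidence μ c L g y := by
  refine (integral_pos_iff_support_of_nonneg (fun x => (gaussianKernel_pos hc _).le)
    (integrable_gaussianKernel_sub hc hg y)).2 ?_
  have : Function.support (fun x => gaussianKernel c L (y - g x)) = Set.univ :=
    Set.eq_univ_of_forall fun x => (gaussianKernel_pos hc _).ne'
  simp [this]

lemma log_kernelEvidence_le (hc : 0 < c) (hg : Measurable g) (y : E) :
    Real.log (kernelEvidence μ c L g y) ≤ Real.log c := by
  refine Real.log_le_log (kernelEvidence_pos hc hg y) ?_
  have := integral_mono (integrable_gaussianKernel_sub (μ := μ) hc hg y) (integrable_const c)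
    fun x => gaussianKernel_le (L := L) hc (y - g x)
  simpa [kernelEvidence] using this

lemma integrable_sq_norm_sub (hg : Measurable g)
    (hg2 : Integrable (fun x => ‖L (g x)‖ ^ 2) μ) (y : E) :
    Integrable (fun x => ‖L (y - g x)‖ ^ 2) μ := by
  refine Integrable.mono' (((integrable_const (‖L y‖ ^ 2)).add hg2).const_mul 2)
    (((L.continuous.norm).pow 2).measurable.comp (hg.const_sub y)).aestronglyMeasurable
    (ae_of_all _ fun x => ?_)
  rw [Real.norm_of_nonneg (by positivity), map_sub]
  have := norm_sub_le (L y) (L (g x))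
  simp only [Pi.add_apply]
  nlinarith [sq_nonneg (‖L y‖ - ‖L (g x)‖), norm_nonneg (L y - L (g x))]

/-- Jensen's inequality for `exp`. With the upper bound `log c` it shows that the log-evidence grows
at most quadratically, which is what makes it integrable against the joint law. -/
lemma le_log_kernelEvidence (hc : 0 < c) (hg : Measurable g)
    (hg2 : Integrable (fun x => ‖L (g x)‖ ^ 2) μ) (y : E) :
    Real.log c - ‖L y‖ ^ 2 - ∫ x, ‖L (g x)‖ ^ 2 ∂μ ≤ Real.log (kernelEvidence μ c L g y) := by
  have hi := integrable_sq_norm_sub hg hg2 y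
  have hle : ∫ x, ‖L (y - g x)‖ ^ 2 ∂μ ≤ 2 * (‖L y‖ ^ 2 + ∫ x, ‖L (g x)‖ ^ 2 ∂μ) := by
    have : ∫ x, 2 * (‖L y‖ ^ 2 + ‖L (g x)‖ ^ 2) ∂μ
        = 2 * (‖L y‖ ^ 2 + ∫ x, ‖L (g x)‖ ^ 2 ∂μ) := by
      rw [integral_const_mul, integral_add (integrable_const _) hg2]; simp
    rw [← this]
    refine integral_mono hi (((integrable_const (‖L y‖ ^ 2)).add hg2).const_mul 2) fun x => ?_
    have := norm_sub_le (L y) (L (g x))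
    simp only [map_sub]
    nlinarith [sq_nonneg (‖L y‖ - ‖L (g x)‖), norm_nonneg (L y - L (g x))]
  have hexp : Integrable (fun x => Real.exp (-(1 / 2) * ‖L (y - g x)‖ ^ 2)) μ := by
    simpa [gaussianKernel, hc.ne'] using
      (integrable_gaussianKernel_sub (μ := μ) (L := L) hc hg y).const_mul c⁻¹
  have hJ := convexOn_exp.map_integral_le (μ := μ) (f := fun x => -(1 / 2) * ‖L (y - g x)‖ ^ 2)
    Real.continuous_exp.continuousOn isClosed_univ (by simp) (hi.const_mul _) hexp
  rw [integral_const_mul] at hJ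
  rw [Real.le_log_iff_exp_le (kernelEvidence_pos hc hg y)]
  have hev : kernelEvidence μ c L g y = c * ∫ x, Real.exp (-(1 / 2) * ‖L (y - g x)‖ ^ 2) ∂μ := by
    simp only [kernelEvidence, gaussianKernel, integral_const_mul]
  rw [hev]
  calc _ = c * Real.exp (-‖L y‖ ^ 2 - ∫ x, ‖L (g x)‖ ^ 2 ∂μ) := by
        rw [sub_sub, sub_eq_add_neg, Real.exp_add, Real.exp_log hc]; ring_nf
    _ ≤ c * Real.exp (-(1 / 2) * ∫ x, ‖L (y - g x)‖ ^ 2 ∂μ) := by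
        gcongr; linarith
    _ ≤ _ := by gcongr

lemma abs_log_kernelEvidence_le (hc : 0 < c) (hg : Measurable g)
    (hg2 : Integrable (fun x => ‖L (g x)‖ ^ 2) μ) (y : E) :
    |Real.log (kernelEvidence μ c L g y)|
      ≤ |Real.log c| + ‖L y‖ ^ 2 + ∫ x, ‖L (g x)‖ ^ 2 ∂μ := by
  have h1 := log_kernelEvidence_le (μ := μ) (L := L) hc hg y
  have h2 := le_log_kernelEvidence hc hg hg2 y
  have h3 : 0 ≤ ∫ x, ‖L (g x)‖ ^ 2 ∂μ := integral_nonneg fun x => by positivity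
  rw [abs_le]
  constructor <;> nlinarith [le_abs_self (Real.log c), neg_abs_le (Real.log c), sq_nonneg ‖L y‖]

/-- One-sided modulus of continuity of the log-evidence, in terms of the posterior mean
of the squared residual. -/
lemma log_kernelEvidence_sub_le (hc : 0 < c) (hg : Measurable g) {t : ℝ} (ht : 0 < t) (y δ : E) :
    Real.log (kernelEvidence μ c L g y) - Real.log (kernelEvidence μ c L g (y - δ))
      ≤ (1 + t⁻¹) / 2 * ‖L δ‖ ^ 2
        + t / 2 * (residualEvidence μ c L g y / kernelEvidence μ c L g y) := by
  set a := (1 + t⁻¹) / 2 * ‖L δ‖ ^ 2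
  set ρ := kernelEvidence μ c L g y with hρ
  set q := t / 2 * (residualEvidence μ c L g y / ρ) with hq
  have hρ0 : 0 < ρ := kernelEvidence_pos hc hg y
  -- Bound the exponential below by its tangent at `q`, the posterior mean of `t / 2 * ‖L (y - g x)‖
  -- ^ 2`. This is Jensen's inequality for the posterior, without introducing that measure.
  have hpt (x : X) : Real.exp (-(a + q)) * ((1 + q) * gaussianKernel c L (y - g x)
      - t / 2 * (‖L (y - g x)‖ ^ 2 * gaussianKernel c L (y - g x)))
      ≤ gaussianKernel c L (y - δ - g x) := by
    set w := y - g x with hw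
    have hwd : y - δ - g x = w - δ := by rw [hw]; abel
    have hn : 1 / 2 * ‖L (w - δ)‖ ^ 2 ≤ 1 / 2 * ‖L w‖ ^ 2 + (a + t / 2 * ‖L w‖ ^ 2) := by
      rw [map_sub]
      have h1 := norm_sub_le (L w) (L δ)
      have h2 : ‖L (w) - L δ‖ ^ 2 ≤ (‖L w‖ + ‖L δ‖) ^ 2 := by gcongr
      -- Young's inequality with weight `t`.
      have h3 : 2 * ‖L w‖ * ‖L δ‖ ≤ t * ‖L w‖ ^ 2 + t⁻¹ * ‖L δ‖ ^ 2 := by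
        have h4 := mul_nonneg (inv_nonneg.2 ht.le) (sq_nonneg (t * ‖L w‖ - ‖L δ‖))
        have h5 : t⁻¹ * (t * ‖L w‖ - ‖L δ‖) ^ 2
            = t * ‖L w‖ ^ 2 + t⁻¹ * ‖L δ‖ ^ 2 - 2 * ‖L w‖ * ‖L δ‖ := by field_simp; ring
        linarith
      simp only [a]
      nlinarith
    have htan : Real.exp (-(a + q)) * (1 + q - t / 2 * ‖L w‖ ^ 2)
        ≤ Real.exp (-(a + t / 2 * ‖L w‖ ^ 2)) := by
      have : Real.exp (-(a + t / 2 * ‖L w‖ ^ 2))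
          = Real.exp (-(a + q)) * Real.exp (q - t / 2 * ‖L w‖ ^ 2) := by
        rw [← Real.exp_add]; ring_nf
      rw [this]
      gcongr
      linarith [Real.add_one_le_exp (q - t / 2 * ‖L w‖ ^ 2)]
    calc _ = gaussianKernel c L w * (Real.exp (-(a + q)) * (1 + q - t / 2 * ‖L w‖ ^ 2)) := by ring
      _ ≤ gaussianKernel c L w * Real.exp (-(a + t / 2 * ‖L w‖ ^ 2)) := by
          gcongr; exact (gaussianKernel_pos hc _).le
      _ = c * Real.exp (-(1 / 2 * ‖L w‖ ^ 2 + (a + t / 2 * ‖L w‖ ^ 2))) := by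
          rw [gaussianKernel, mul_assoc, ← Real.exp_add]; ring_nf
      _ ≤ c * Real.exp (-(1 / 2 * ‖L (w - δ)‖ ^ 2)) := by gcongr
      _ = _ := by rw [hwd, gaussianKernel]; ring_nf
  have h1 := integrable_gaussianKernel_sub (μ := μ) (L := L) hc hg y
  have h2 := integrable_sq_mul_gaussianKernel_sub (μ := μ) (L := L) hc hg y
  have hint := integral_mono (((h1.const_mul (1 + q)).sub (h2.const_mul (t / 2))).const_mul
    (Real.exp (-(a + q)))) (integrable_gaussianKernel_sub (μ := μ) hc hg (y - δ)) hpt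
  rw [integral_const_mul, integral_sub' (h1.const_mul _) (h2.const_mul _), integral_const_mul,
    integral_const_mul] at hint
  change Real.exp (-(a + q)) * ((1 + q) * ρ - t / 2 * residualEvidence μ c L g y)
    ≤ kernelEvidence μ c L g (y - δ) at hint
  -- By the choice of `q`, the linear term of the tangent integrates to zero and only `ρ` remains.
  have hqρ : t / 2 * residualEvidence μ c L g y = q * ρ := by rw [hq]; field_simp
  rw [hqρ, show (1 + q) * ρ - q * ρ = ρ by ring] at hint
  have := Real.log_le_log (by positivity) hint
  rw [Real.log_mul (Real.exp_pos _).ne' hρ0.ne', Real.log_exp] at this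
  linarith

end FixedData

end

end BayesOED

/-! ### The joint law of noise and parameter, and stability of the expected utility -/

namespace BayesOED

noncomputable section

section Joint

variable {X E : Type*} [MeasurableSpace X] {μ : Measure X} [IsProbabilityMeasure μ]
  [NormedAddCommGroup E] [NormedSpace ℝ E] [MeasureSpace E]
  {c : ℝ} {L : E →L[ℝ] E} {g h : X → E}

lemma integrable_log_gaussianKernel_mul (hc : 0 < c) (hk : Integrable (gaussianKernel c L))
    (hk2 : Integrable fun v => ‖L v‖ ^ 2 * gaussianKernel c L v) :
    Integrable (fun v => Real.log (gaussianKernel c L v) * gaussianKernel c L v) := by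
  refine ((hk.const_mul (Real.log c)).sub (hk2.const_mul (1 / 2))).congr (ae_of_all _ fun v => ?_)
  have : Real.log (gaussianKernel c L v) = Real.log c - 1 / 2 * ‖L v‖ ^ 2 := by
    rw [gaussianKernel, Real.log_mul hc.ne' (Real.exp_pos _).ne', Real.log_exp]; ring
  simp only [this, Pi.sub_apply]
  ring

variable [BorelSpace E] [SecondCountableTopology E]

/-- The shear `(v, x) ↦ (v + g x, x)`. -/
def shear (g : X → E) (hg : Measurable g) : E × X ≃ᵐ E × X where
  toFun z := (z.1 + g z.2, z.2)
  invFun z := (z.1 - g z.2, z.2)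
  left_inv z := by simp
  right_inv z := by simp
  measurable_toFun := by
    exact (measurable_fst.add (hg.comp measurable_snd)).prodMk measurable_snd
  measurable_invFun := by
    exact (measurable_fst.sub (hg.comp measurable_snd)).prodMk measurable_snd

lemma measurable_kernelEvidence (hg : Measurable g) : Measurable (kernelEvidence μ c L g) := by
  have : StronglyMeasurable
      (Function.uncurry fun (y : E) (x : X) => gaussianKernel c L (y - g x)) :=
    (continuous_gaussianKernel.measurable.comp
      (measurable_fst.sub (hg.comp measurable_snd))).stronglyMeasurable
  exact this.integral_prod_right.measurable

lemma measurable_residualEvidence (hg : Measurable g) :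
    Measurable (residualEvidence μ c L g) := by
  have hm : Measurable fun v => ‖L v‖ ^ 2 * gaussianKernel c L v :=
    (((L.continuous.norm).pow 2).mul continuous_gaussianKernel).measurable
  have : StronglyMeasurable (Function.uncurry fun (y : E) (x : X) =>
      ‖L (y - g x)‖ ^ 2 * gaussianKernel c L (y - g x)) :=
    (hm.comp (measurable_fst.sub (hg.comp measurable_snd))).stronglyMeasurable
  exact this.integral_prod_right.measurable

/-- Two maps are allowed because Gibbs' inequality needs the cross term: the evidence of `g` at data
generated by `h`. -/
lemma integrable_log_kernelEvidence_mul (hc : 0 < c) (hk : Integrable (gaussianKernel c L))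
    (hk2 : Integrable fun v => ‖L v‖ ^ 2 * gaussianKernel c L v)
    (hg : Measurable g) (hh : Measurable h)
    (hg2 : Integrable (fun x => ‖L (g x)‖ ^ 2) μ) (hh2 : Integrable (fun x => ‖L (h x)‖ ^ 2) μ) :
    Integrable (fun z : E × X =>
      Real.log (kernelEvidence μ c L g (z.1 + h z.2)) * gaussianKernel c L z.1)
      ((volume : Measure E).prod μ) := by
  set M := |Real.log c| + ∫ x, ‖L (g x)‖ ^ 2 ∂μ
  have hdom : Integrable (fun z : E × X => M * gaussianKernel c L z.1
      + 2 * (‖L z.1‖ ^ 2 * gaussianKernel c L z.1)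
      + 2 * (gaussianKernel c L z.1 * ‖L (h z.2)‖ ^ 2)) ((volume : Measure E).prod μ) :=
    (((hk.comp_fst μ).const_mul M).add ((hk2.comp_fst μ).const_mul 2)).add
      ((hk.mul_prod hh2).const_mul 2)
  refine hdom.mono' ?_ (ae_of_all _ fun z => ?_)
  · exact ((Real.measurable_log.comp ((measurable_kernelEvidence hg).comp
      (measurable_fst.add (hh.comp measurable_snd)))).mul
      (continuous_gaussianKernel.measurable.comp measurable_fst)).aestronglyMeasurable
  · rw [norm_mul, Real.norm_eq_abs, Real.norm_of_nonneg (gaussianKernel_pos hc _).le]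
    have h1 := abs_log_kernelEvidence_le hc hg hg2 (z.1 + h z.2)
    have h2 : ‖L (z.1 + h z.2)‖ ^ 2 ≤ 2 * ‖L z.1‖ ^ 2 + 2 * ‖L (h z.2)‖ ^ 2 := by
      rw [map_add]
      have := norm_add_le (L z.1) (L (h z.2))
      nlinarith [sq_nonneg (‖L z.1‖ - ‖L (h z.2)‖), norm_nonneg (L z.1 + L (h z.2))]
    calc _ ≤ (M + 2 * ‖L z.1‖ ^ 2 + 2 * ‖L (h z.2)‖ ^ 2) * gaussianKernel c L z.1 := by
          refine mul_le_mul_of_nonneg_right ?_ (gaussianKernel_pos hc _).le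
          simp only [M]; linarith
      _ = _ := by ring

variable [SigmaFinite (volume : Measure E)] [(volume : Measure E).IsAddRightInvariant]

-- On each fibre over `x` the shear is a translation; the swaps put `x` first, as a skew product
-- requires.
omit [NormedSpace ℝ E] in
lemma measurePreserving_shear (hg : Measurable g) :
    MeasurePreserving (shear g hg) ((volume : Measure E).prod μ) (volume.prod μ) := by
  have h1 : MeasurePreserving (fun z : X × E => (z.1, z.2 + g z.1))
      (μ.prod (volume : Measure E)) (μ.prod volume) :=
    (MeasurePreserving.id μ).skew_product
      (g := fun x v => v + g x) (measurable_snd.add (hg.comp measurable_fst))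
      (ae_of_all _ fun x => (measurePreserving_add_right volume (g x)).map_eq)
  exact (Measure.measurePreserving_swap.comp h1).comp Measure.measurePreserving_swap

/-- Passes between data `y` and noise `v = y - g x`. The shear is a measurable equivalence, so `F`
may be arbitrary. -/
lemma integrable_mul_gaussianKernel_sub_iff (hg : Measurable g) (F : E × X → ℝ) :
    Integrable (fun z : E × X => F z * gaussianKernel c L (z.1 - g z.2))
        ((volume : Measure E).prod μ)
      ↔ Integrable (fun z : E × X => F (z.1 + g z.2, z.2) * gaussianKernel c L z.1)
        ((volume : Measure E).prod μ) := by
  rw [← (measurePreserving_shear (μ := μ) hg).integrable_comp_emb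
    (shear g hg).measurableEmbedding]
  simp [Function.comp_def, shear]

lemma integral_mul_gaussianKernel_sub (hg : Measurable g) (F : E × X → ℝ) :
    ∫ z : E × X, F z * gaussianKernel c L (z.1 - g z.2) ∂((volume : Measure E).prod μ)
      = ∫ z : E × X, F (z.1 + g z.2, z.2) * gaussianKernel c L z.1
        ∂((volume : Measure E).prod μ) := by
  rw [← (measurePreserving_shear (μ := μ) hg).integral_comp
    (shear g hg).measurableEmbedding]
  simp [shear]

lemma integrable_kernelEvidence (hk : Integrable (gaussianKernel c L)) (hg : Measurable g) :
    Integrable (kernelEvidence μ c L g) := by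
  have := (integrable_mul_gaussianKernel_sub_iff (μ := μ) (c := c) (L := L) hg
    (fun _ => (1 : ℝ))).2 (by simpa using hk.comp_fst μ)
  simpa only [one_mul] using! this.integral_prod_left

lemma integral_kernelEvidence (hk : Integrable (gaussianKernel c L)) (hg : Measurable g) :
    ∫ y, kernelEvidence μ c L g y = ∫ v, gaussianKernel c L v := by
  have h1 := (integrable_mul_gaussianKernel_sub_iff (μ := μ) (c := c) (L := L) hg
    (fun _ => (1 : ℝ))).2 (by simpa using hk.comp_fst μ)
  have h2 := integral_mul_gaussianKernel_sub (μ := μ) (c := c) (L := L) hg (fun _ => (1 : ℝ))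
  rw [integral_prod _ h1] at h2
  simpa [kernelEvidence, integral_fun_fst] using h2

section Moments

variable (hc : 0 < c) (hk : Integrable (gaussianKernel c L))
  (hk2 : Integrable fun v => ‖L v‖ ^ 2 * gaussianKernel c L v)
include hc hk hk2

lemma finiteUtility_kernelLikelihood (hg : Measurable g)
    (hg2 : Integrable (fun x => ‖L (g x)‖ ^ 2) μ) :
    FiniteUtility μ (kernelLikelihood c L g) := by
  refine (integrable_mul_gaussianKernel_sub_iff (μ := μ) (c := c) (L := L) hg (fun z =>
    Real.log (gaussianKernel c L (z.1 - g z.2) / kernelEvidence μ c L g z.1))).2 ?_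
  refine (((integrable_log_gaussianKernel_mul hc hk hk2).comp_fst μ).sub
    (integrable_log_kernelEvidence_mul hc hk hk2 hg hg hg2 hg2)).congr (ae_of_all _ fun z => ?_)
  simp only [Pi.sub_apply, add_sub_cancel_right]
  rw [Real.log_div (gaussianKernel_pos hc _).ne' (kernelEvidence_pos hc hg _).ne']
  ring

/-- Isolates the dependence on `g`: the first term is a constant of the noise and cancels in
differences. -/
lemma expectedUtility_kernelLikelihood (hg : Measurable g)
    (hg2 : Integrable (fun x => ‖L (g x)‖ ^ 2) μ) :
    expectedUtility μ (kernelLikelihood c L g)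
      = (∫ v, Real.log (gaussianKernel c L v) * gaussianKernel c L v)
        - ∫ z : E × X, Real.log (kernelEvidence μ c L g (z.1 + g z.2)) * gaussianKernel c L z.1
          ∂((volume : Measure E).prod μ) := by
  have h0 := integral_prod _ (finiteUtility_kernelLikelihood hc hk hk2 hg hg2)
  have h1 := integral_mul_gaussianKernel_sub (μ := μ) (c := c) (L := L) hg (fun z =>
    Real.log (gaussianKernel c L (z.1 - g z.2) / kernelEvidence μ c L g z.1))
  have h2 := integral_sub ((integrable_log_gaussianKernel_mul hc hk hk2).comp_fst μ)
    (integrable_log_kernelEvidence_mul hc hk hk2 hg hg hg2 hg2)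
  rw [integral_fun_fst (fun v => Real.log (gaussianKernel c L v) * gaussianKernel c L v)] at h2
  simp only [probReal_univ, one_smul] at h2
  rw [← h2, expectedUtility, ← h0]
  refine h1.trans (integral_congr_ae (ae_of_all _ fun z => ?_))
  simp only [add_sub_cancel_right]
  rw [Real.log_div (gaussianKernel_pos hc _).ne' (kernelEvidence_pos hc hg _).ne']
  ring

/-- Gibbs' inequality for two mixtures of the same kernel. -/
lemma integral_log_kernelEvidence_mul_le (hg : Measurable g) (hh : Measurable h)
    (hg2 : Integrable (fun x => ‖L (g x)‖ ^ 2) μ) (hh2 : Integrable (fun x => ‖L (h x)‖ ^ 2) μ) :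
    ∫ z : E × X, Real.log (kernelEvidence μ c L g (z.1 + h z.2)) * gaussianKernel c L z.1
        ∂((volume : Measure E).prod μ)
      ≤ ∫ z : E × X, Real.log (kernelEvidence μ c L h (z.1 + h z.2)) * gaussianKernel c L z.1
        ∂((volume : Measure E).prod μ) := by
  set F : E × X → ℝ := fun z =>
    Real.log (kernelEvidence μ c L g z.1) - Real.log (kernelEvidence μ c L h z.1)
  have hgh := integrable_log_kernelEvidence_mul hc hk hk2 hg hh hg2 hh2
  have hhh := integrable_log_kernelEvidence_mul hc hk hk2 hh hh hh2 hh2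
  have hF : Integrable (fun z : E × X => F (z.1 + h z.2, z.2) * gaussianKernel c L z.1)
      ((volume : Measure E).prod μ) := by
    simpa only [F, sub_mul] using! hgh.sub hhh
  have hF' := (integrable_mul_gaussianKernel_sub_iff hh F).2 hF
  have hinner (y : E) : ∫ x, F (y, x) * gaussianKernel c L (y - h x) ∂μ
      = (Real.log (kernelEvidence μ c L g y) - Real.log (kernelEvidence μ c L h y))
        * kernelEvidence μ c L h y := by
    simp only [F, integral_const_mul, kernelEvidence]
  have hle : ∫ z : E × X, F z * gaussianKernel c L (z.1 - h z.2) ∂((volume : Measure E).prod μ)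
      ≤ 0 := by
    -- Both mixtures have the mass of the kernel, so the bound produced by `log u ≤ u - 1`
    -- integrates to zero.
    have hzero : ∫ y, (kernelEvidence μ c L g y - kernelEvidence μ c L h y) = 0 := by
      rw [integral_sub (integrable_kernelEvidence hk hg) (integrable_kernelEvidence hk hh),
        integral_kernelEvidence hk hg, integral_kernelEvidence hk hh, sub_self]
    rw [integral_prod _ hF', ← hzero]
    refine integral_mono hF'.integral_prod_left
      ((integrable_kernelEvidence hk hg).sub (integrable_kernelEvidence hk hh)) fun y => ?_
    simp only [hinner]
    have ha := kernelEvidence_pos (μ := μ) (L := L) hc hg y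
    have hb := kernelEvidence_pos (μ := μ) (L := L) hc hh y
    have hlog := Real.log_le_sub_one_of_pos (div_pos ha hb)
    rw [Real.log_div ha.ne' hb.ne'] at hlog
    calc _ ≤ (kernelEvidence μ c L g y / kernelEvidence μ c L h y - 1)
          * kernelEvidence μ c L h y := by gcongr
      _ = _ := by field_simp
  rw [integral_mul_gaussianKernel_sub hh F] at hle
  have hsub := integral_sub hgh hhh
  simp only [F, sub_mul] at hle
  rw [hsub] at hle
  linarith

omit hk in
/-- Averaged over the joint law, the posterior mean of the squared residual is the second moment
of the noise. -/
lemma integrable_and_integral_posterior_residual (hg : Measurable g) :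
    Integrable (fun z : E × X => residualEvidence μ c L g (z.1 + g z.2)
        / kernelEvidence μ c L g (z.1 + g z.2) * gaussianKernel c L z.1)
        ((volume : Measure E).prod μ) ∧
      ∫ z : E × X, residualEvidence μ c L g (z.1 + g z.2)
        / kernelEvidence μ c L g (z.1 + g z.2) * gaussianKernel c L z.1
        ∂((volume : Measure E).prod μ) = ∫ v, ‖L v‖ ^ 2 * gaussianKernel c L v := by
  set F : E × X → ℝ := fun z => residualEvidence μ c L g z.1 / kernelEvidence μ c L g z.1
  have hFm : Measurable F := ((measurable_residualEvidence hg).div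
    (measurable_kernelEvidence hg)).comp measurable_fst
  have hres0 (y : E) : 0 ≤ residualEvidence μ c L g y :=
    integral_nonneg fun x => mul_nonneg (by positivity) (gaussianKernel_pos hc _).le
  have hinner (y : E) : ∫ x, F (y, x) * gaussianKernel c L (y - g x) ∂μ
      = residualEvidence μ c L g y := by
    have : (∫ x, F (y, x) * gaussianKernel c L (y - g x) ∂μ)
        = residualEvidence μ c L g y / kernelEvidence μ c L g y * kernelEvidence μ c L g y := by
      simp only [F, integral_const_mul, kernelEvidence]
    rw [this, div_mul_cancel₀ _ (kernelEvidence_pos hc hg y).ne']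
  have hQ := (integrable_mul_gaussianKernel_sub_iff (μ := μ) (c := c) (L := L) hg
    (fun z => ‖L (z.1 - g z.2)‖ ^ 2)).2 (by simpa using hk2.comp_fst μ)
  have hQi := integral_mul_gaussianKernel_sub (μ := μ) (c := c) (L := L) hg
    (fun z => ‖L (z.1 - g z.2)‖ ^ 2)
  have hF0 (z : E × X) : 0 ≤ F z * gaussianKernel c L (z.1 - g z.2) :=
    mul_nonneg (div_nonneg (hres0 _) (kernelEvidence_pos hc hg _).le) (gaussianKernel_pos hc _).le
  have hF : Integrable (fun z : E × X => F z * gaussianKernel c L (z.1 - g z.2))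
      ((volume : Measure E).prod μ) := by
    -- Integrating out `x` first turns the kernel into the evidence, which cancels the denominator
    -- and leaves `residualEvidence`.
    refine (integrable_prod_iff ?_).2 ⟨ae_of_all _ fun y => ?_, ?_⟩
    · exact (hFm.mul (continuous_gaussianKernel.measurable.comp
        (measurable_fst.sub (hg.comp measurable_snd)))).aestronglyMeasurable
    · exact (integrable_gaussianKernel_sub (μ := μ) hc hg y).const_mul 
        (residualEvidence μ c L g y / kernelEvidence μ c L g y)
    · refine hQ.integral_prod_left.congr (ae_of_all _ fun y => ?_)
      simp only [Real.norm_of_nonneg (hF0 (y, _))]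
      exact (hinner y).symm
  refine ⟨(integrable_mul_gaussianKernel_sub_iff hg F).1 hF, ?_⟩
  have h1 := integral_mul_gaussianKernel_sub (μ := μ) (c := c) (L := L) hg F
  refine h1.symm.trans ?_
  rw [integral_prod _ hF]
  simp only [hinner]
  rw [integral_prod _ hQ] at hQi
  simp only [add_sub_cancel_right] at hQi
  rw [integral_fun_fst (fun v => ‖L v‖ ^ 2 * gaussianKernel c L v)] at hQi
  simpa only [probReal_univ, one_smul] using! hQi

/-- Gibbs' inequality leaves a single evidence, that of `g`, so its modulus of continuity with `δ =
g x - h x` can be averaged over the joint law. -/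
lemma expectedUtility_sub_le (hg : Measurable g) (hh : Measurable h)
    (hg2 : Integrable (fun x => ‖L (g x)‖ ^ 2) μ) (hh2 : Integrable (fun x => ‖L (h x)‖ ^ 2) μ)
    (hgh : Integrable (fun x => ‖L (g x - h x)‖ ^ 2) μ) {t : ℝ} (ht : 0 < t) :
    expectedUtility μ (kernelLikelihood c L h) - expectedUtility μ (kernelLikelihood c L g)
      ≤ (1 + t⁻¹) / 2 * ((∫ v, gaussianKernel c L v) * ∫ x, ‖L (g x - h x)‖ ^ 2 ∂μ)
        + t / 2 * ∫ v, ‖L v‖ ^ 2 * gaussianKernel c L v := by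
  rw [expectedUtility_kernelLikelihood hc hk hk2 hg hg2,
    expectedUtility_kernelLikelihood hc hk hk2 hh hh2]
  have hgibbs := integral_log_kernelEvidence_mul_le hc hk hk2 hg hh hg2 hh2
  obtain ⟨hS, hSi⟩ := integrable_and_integral_posterior_residual (μ := μ) hc hk2 hg
  have igg := integrable_log_kernelEvidence_mul hc hk hk2 hg hg hg2 hg2
  have igh := integrable_log_kernelEvidence_mul hc hk hk2 hg hh hg2 hh2
  have hδ := (hk.mul_prod hgh).const_mul ((1 + t⁻¹) / 2)
  have hmono := integral_mono (igg.sub igh) (hδ.add (hS.const_mul (t / 2))) fun z => by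
    have := log_kernelEvidence_sub_le (μ := μ) (L := L) hc hg ht (z.1 + g z.2) (g z.2 - h z.2)
    rw [show z.1 + g z.2 - (g z.2 - h z.2) = z.1 + h z.2 by abel] at this
    simp only [Pi.sub_apply, Pi.add_apply]
    rw [← sub_mul]
    calc _ ≤ _ := mul_le_mul_of_nonneg_right this (gaussianKernel_pos hc z.1).le
      _ = _ := by ring
  rw [integral_sub' igg igh, integral_add' hδ (hS.const_mul (t / 2)), integral_const_mul,
    integral_const_mul, hSi, integral_prod_mul (gaussianKernel c L)
      (fun x => ‖L (g x - h x)‖ ^ 2)] at hmono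
  linarith

lemma expectedUtility_sub_le_mul (hg : Measurable g) (hh : Measurable h)
    (hg2 : Integrable (fun x => ‖L (g x)‖ ^ 2) μ) (hh2 : Integrable (fun x => ‖L (h x)‖ ^ 2) μ)
    (hgh : Integrable (fun x => ‖L (g x - h x)‖ ^ 2) μ) {s : ℝ} (hs0 : 0 ≤ s) (hs1 : s ≤ 1)
    (hs : ∫ x, ‖L (g x - h x)‖ ^ 2 ∂μ ≤ s ^ 2) :
    expectedUtility μ (kernelLikelihood c L h) - expectedUtility μ (kernelLikelihood c L g)
      ≤ ((∫ v, gaussianKernel c L v) + ∫ v, ‖L v‖ ^ 2 * gaussianKernel c L v) * s := by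
  set A := ∫ v, gaussianKernel c L v
  set B := ∫ v, ‖L v‖ ^ 2 * gaussianKernel c L v
  have hA : 0 ≤ A := integral_nonneg fun v => (gaussianKernel_pos hc v).le
  have hB : 0 ≤ B := integral_nonneg fun v =>
    mul_nonneg (by positivity) (gaussianKernel_pos hc v).le
  have key {t : ℝ} (ht : 0 < t) := expectedUtility_sub_le hc hk hk2 hg hh hg2 hh2 hgh ht
  rcases hs0.eq_or_lt with rfl | hs0
  · have hz : ∫ x, ‖L (g x - h x)‖ ^ 2 ∂μ = 0 :=
      le_antisymm (by simpa using hs) (integral_nonneg fun x => by positivity)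
    rw [mul_zero]
    refine le_of_forall_pos_le_add fun ε hε => ?_
    -- At `s = 0` only `t / 2 * B` survives, and this `t` makes it at most `ε`.
    have := key (t := ε / (B + 1)) (by positivity)
    rw [hz, mul_zero, mul_zero, zero_add] at this
    refine this.trans ?_
    rw [zero_add, div_div, div_mul_eq_mul_div, div_le_iff₀ (by positivity)]
    nlinarith
  -- The choice `t = s` balances the two terms; `s ≤ 1` then gives `(s + 1) / 2 ≤ 1`.
  · refine (key hs0).trans ?_
    have h1 : (1 + s⁻¹) / 2 * (A * ∫ x, ‖L (g x - h x)‖ ^ 2 ∂μ) ≤ (1 + s⁻¹) / 2 * (A * s ^ 2) := by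
      gcongr
    have h2 : (1 + s⁻¹) / 2 * (A * s ^ 2) = (s + 1) / 2 * (A * s) := by field_simp
    nlinarith [mul_nonneg hA hs0.le, mul_nonneg hB hs0.le]

lemma abs_expectedUtility_sub_le (hg : Measurable g) (hh : Measurable h)
    (hg2 : Integrable (fun x => ‖L (g x)‖ ^ 2) μ) (hh2 : Integrable (fun x => ‖L (h x)‖ ^ 2) μ)
    (hgh : Integrable (fun x => ‖L (g x - h x)‖ ^ 2) μ) {s : ℝ} (hs0 : 0 ≤ s) (hs1 : s ≤ 1)
    (hs : ∫ x, ‖L (g x - h x)‖ ^ 2 ∂μ ≤ s ^ 2) :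
    |expectedUtility μ (kernelLikelihood c L g) - expectedUtility μ (kernelLikelihood c L h)|
      ≤ ((∫ v, gaussianKernel c L v) + ∫ v, ‖L v‖ ^ 2 * gaussianKernel c L v) * s := by
  have hsymm : (fun x => ‖L (h x - g x)‖ ^ 2) = fun x => ‖L (g x - h x)‖ ^ 2 := by
    funext x; rw [map_sub, map_sub, norm_sub_rev]
  rw [abs_sub_le_iff]
  exact ⟨expectedUtility_sub_le_mul hc hk hk2 hh hg hh2 hg2 (hsymm ▸ hgh) hs0 hs1 (hsymm ▸ hs),
    expectedUtility_sub_le_mul hc hk hk2 hg hh hg2 hh2 hgh hs0 hs1 hs⟩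

end Moments

end Joint

end

end BayesOED

/-! ### Continuity of the expected utility under pointwise convergence -/

namespace BayesOED

noncomputable section

section Convergence

variable {X : Type*} [MeasurableSpace X] {μ : Measure X}

/-- The maximum appears because `ENNReal.ofReal` truncates a negative `C` to zero. -/
lemma integrable_and_integral_le_of_lintegral_ofReal_le {f : X → ℝ} (hf : Measurable f)
    (hf0 : ∀ x, 0 ≤ f x) {C : ℝ} (hC : ∫⁻ x, ENNReal.ofReal (f x) ∂μ ≤ ENNReal.ofReal C) :
    Integrable f μ ∧ ∫ x, f x ∂μ ≤ max C 0 := by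
  refine ⟨⟨hf.aestronglyMeasurable, (hasFiniteIntegral_iff_ofReal (ae_of_all _ hf0)).2
    (hC.trans_lt ENNReal.ofReal_lt_top)⟩, ?_⟩
  rw [integral_eq_lintegral_of_nonneg_ae (ae_of_all _ hf0) hf.aestronglyMeasurable]
  calc _ ≤ (ENNReal.ofReal C).toReal := ENNReal.toReal_mono ENNReal.ofReal_ne_top hC
    _ = _ := ENNReal.toReal_ofReal'

lemma integrable_sq_of_integrable_pow_four [IsProbabilityMeasure μ] {f : X → ℝ}
    (hf : Measurable f) (hf4 : Integrable (fun x => f x ^ 4) μ) : Integrable (fun x => f x ^ 2) μ := by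
  refine ((integrable_const (1 : ℝ)).add hf4).mono' (hf.pow_const 2).aestronglyMeasurable
    (ae_of_all _ fun x => ?_)
  rw [Real.norm_of_nonneg (by positivity)]
  simp only [Pi.add_apply]
  nlinarith [sq_nonneg (f x ^ 2 - 1)]

/-- Vitali's theorem for nonnegative functions bounded in `L²`. -/
lemma tendsto_integral_zero_of_integral_sq_le [IsProbabilityMeasure μ] {f : ℕ → X → ℝ}
    (hf : ∀ n, Measurable (f n)) (hf0 : ∀ n x, 0 ≤ f n x) (hf2 : ∀ n, Integrable (fun x => f n x ^ 2) μ) {K : ℝ}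
    (hK : ∀ n, ∫ x, f n x ^ 2 ∂μ ≤ K) (hlim : ∀ x, Tendsto (fun n => f n x) atTop (𝓝 0)) :
    Tendsto (fun n => ∫ x, f n x ∂μ) atTop (𝓝 0) := by
  have hK0 : 0 ≤ K := (integral_nonneg fun x => by positivity).trans (hK 0)
  refine (tendsto_order.2 ⟨fun a ha => Eventually.of_forall fun n =>
    ha.trans_le (integral_nonneg (hf0 n)), fun ε hε => ?_⟩)
  -- Truncation level for `f ≤ min f R + f ^ 2 / R`: the tail contributes at most `K / R ≤ ε / 2`.
  -- The `+ 1` keeps `R` positive when `K = 0`.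
  set R := 2 * (K + 1) / ε with hR
  have hR0 : 0 < R := by positivity
  have htrunc : Tendsto (fun n => ∫ x, min (f n x) R ∂μ) atTop (𝓝 (∫ _, (0 : ℝ) ∂μ)) := by
    refine tendsto_integral_of_dominated_convergence (fun _ => R)
      (fun n => ((hf n).min measurable_const).aestronglyMeasurable) (integrable_const R)
      (fun n => ae_of_all _ fun x => ?_) (ae_of_all _ fun x => ?_)
    · rw [Real.norm_of_nonneg (le_min (hf0 n x) hR0.le)]
      exact min_le_right _ _
    · simpa [min_eq_left hR0.le] using (hlim x).min (tendsto_const_nhds (x := R))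
  rw [integral_zero] at htrunc
  filter_upwards [htrunc.eventually_lt_const (half_pos hε)] with n hn
  have hmin : Integrable (fun x => min (f n x) R) μ :=
    Integrable.of_bound ((hf n).min measurable_const).aestronglyMeasurable R
      (ae_of_all _ fun x => by
        rw [Real.norm_of_nonneg (le_min (hf0 n x) hR0.le)]; exact min_le_right _ _)
  have hle (x : X) : f n x ≤ min (f n x) R + R⁻¹ * f n x ^ 2 := by
    rcases le_total (f n x) R with h | h
    · rw [min_eq_left h]
      have : 0 ≤ R⁻¹ * f n x ^ 2 := by positivity
      linarith
    · have h1 : f n x ≤ R⁻¹ * f n x ^ 2 := by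
        rw [inv_mul_eq_div, le_div_iff₀ hR0]; nlinarith [hf0 n x]
      linarith [le_min (hf0 n x) hR0.le]
  have hint := integral_mono_of_nonneg (ae_of_all _ (hf0 n))
    (hmin.add ((hf2 n).const_mul R⁻¹)) (ae_of_all _ hle)
  rw [integral_add' hmin ((hf2 n).const_mul R⁻¹), integral_const_mul] at hint
  have h2 : R⁻¹ * ∫ x, f n x ^ 2 ∂μ ≤ ε / 2 := by
    calc _ ≤ R⁻¹ * (K + 1) := by gcongr; linarith [hK n]
      _ = _ := by rw [hR]; field_simp
  linarith

variable {E : Type*} [NormedAddCommGroup E] [NormedSpace ℝ E] [MeasureSpace E] [BorelSpace E]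
  [SecondCountableTopology E] {c : ℝ} {L : E →L[ℝ] E} {g h : X → E}

lemma integrable_sq_norm_map_sub (hg : Measurable g) (hh : Measurable h)
    (hg2 : Integrable (fun x => ‖L (g x)‖ ^ 2) μ) (hh2 : Integrable (fun x => ‖L (h x)‖ ^ 2) μ) :
    Integrable (fun x => ‖L (g x - h x)‖ ^ 2) μ := by
  refine ((hg2.add hh2).const_mul 2).mono' (((L.continuous.norm).pow 2).measurable.comp
    (hg.sub hh)).aestronglyMeasurable (ae_of_all _ fun x => ?_)
  rw [Real.norm_of_nonneg (by positivity), map_sub]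
  have := norm_sub_le (L (g x)) (L (h x))
  simp only [Pi.add_apply]
  nlinarith [sq_nonneg (‖L (g x)‖ - ‖L (h x)‖), norm_nonneg (L (g x) - L (h x))]

/-- The expected utility is continuous under pointwise convergence of the forward maps with
bounded fourth moments. -/
lemma tendsto_expectedUtility_kernelLikelihood [IsProbabilityMeasure μ]
    [SigmaFinite (volume : Measure E)] [(volume : Measure E).IsAddRightInvariant] (hc : 0 < c)
    (hk : Integrable (gaussianKernel c L))
    (hk2 : Integrable fun v => ‖L v‖ ^ 2 * gaussianKernel c L v)
    {gn : ℕ → X → E} (hgn : ∀ n, Measurable (gn n)) (hg : Measurable g) {K : ℝ}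
    (hgn4 : ∀ n, Integrable (fun x => ‖L (gn n x)‖ ^ 4) μ)
    (hg4 : Integrable (fun x => ‖L (g x)‖ ^ 4) μ)
    (hgnK : ∀ n, ∫ x, ‖L (gn n x)‖ ^ 4 ∂μ ≤ K) (hgK : ∫ x, ‖L (g x)‖ ^ 4 ∂μ ≤ K)
    (hlim : ∀ x, Tendsto (fun n => gn n x) atTop (𝓝 (g x))) :
    Tendsto (fun n => expectedUtility μ (kernelLikelihood c L (gn n))) atTop
      (𝓝 (expectedUtility μ (kernelLikelihood c L g))) := by
  have hmL {u : X → E} (hu : Measurable u) : Measurable fun x => ‖L (u x)‖ :=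
    L.continuous.norm.measurable.comp hu
  have hgn2 (n : ℕ) := integrable_sq_of_integrable_pow_four (hmL (hgn n)) (hgn4 n)
  have hg2 := integrable_sq_of_integrable_pow_four (hmL hg) hg4
  have hd2 (n : ℕ) := integrable_sq_norm_map_sub (hgn n) hg (hgn2 n) hg2
  have hm (n : ℕ) : Measurable fun x => ‖L (gn n x - g x)‖ ^ 2 :=
    (hmL ((hgn n).sub hg)).pow_const 2
  -- Fourth moments bound the squared differences in `L²`, which is the hypothesis of the Vitali
  -- argument.
  have hpt (n : ℕ) (x : X) : (‖L (gn n x - g x)‖ ^ 2) ^ 2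
      ≤ 8 * (‖L (gn n x)‖ ^ 4 + ‖L (g x)‖ ^ 4) := by
    rw [map_sub, ← pow_mul]
    calc ‖L (gn n x) - L (g x)‖ ^ (2 * 2) ≤ (‖L (gn n x)‖ + ‖L (g x)‖) ^ 4 := by
          gcongr; exact norm_sub_le _ _
      _ ≤ 2 ^ (4 - 1) * (‖L (gn n x)‖ ^ 4 + ‖L (g x)‖ ^ 4) :=
          add_pow_le (norm_nonneg _) (norm_nonneg _) 4
      _ = _ := by norm_num
  have hdom (n : ℕ) := ((hgn4 n).add hg4).const_mul 8
  have hsq (n : ℕ) : Integrable (fun x => (‖L (gn n x - g x)‖ ^ 2) ^ 2) μ :=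
    (hdom n).mono' ((hm n).pow_const 2).aestronglyMeasurable (ae_of_all _ fun x => by
      rw [Real.norm_of_nonneg (by positivity)]; exact hpt n x)
  have hzero : Tendsto (fun n => ∫ x, ‖L (gn n x - g x)‖ ^ 2 ∂μ) atTop (𝓝 0) := by
    refine tendsto_integral_zero_of_integral_sq_le (K := 8 * (K + K)) hm
      (fun n x => by positivity) hsq (fun n => ?_) fun x => ?_
    · refine (integral_mono (hsq n) (hdom n) (hpt n)).trans ?_
      rw [integral_const_mul, integral_add' (hgn4 n) hg4]
      linarith [hgnK n]
    · have : Tendsto (fun n => gn n x - g x) atTop (𝓝 0) := by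
        simpa using (hlim x).sub_const (g x)
      simpa using ((L.continuous.tendsto 0).comp this).norm.pow 2
  have hsqrt := (Real.continuous_sqrt.tendsto 0).comp hzero
  rw [Real.sqrt_zero] at hsqrt
  have hmul := hsqrt.const_mul
    ((∫ v, gaussianKernel c L v) + ∫ v, ‖L v‖ ^ 2 * gaussianKernel c L v)
  rw [mul_zero] at hmul
  rw [tendsto_iff_norm_sub_tendsto_zero]
  refine squeeze_zero' (Eventually.of_forall fun _ => norm_nonneg _) ?_ hmul
  -- The stability bound applies with `s` the `L²` distance itself, once that is at most 1.
  filter_upwards [hsqrt.eventually_le_const one_pos] with n hn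
  exact abs_expectedUtility_sub_le hc hk hk2 (hgn n) hg (hgn2 n) hg2 (hd2 n) (Real.sqrt_nonneg _) hn
    (Real.sq_sqrt (integral_nonneg fun x => by positivity)).ge

end Convergence

/-! ### Integrability of the Gaussian density and its second moment -/

section GaussianIntegrability

variable {p : ℕ} {Γ : Matrix (Fin p) (Fin p) ℝ}

/-- The whitening map `v ↦ Γ^{-1/2} v`. -/
def whitening (Γ : Matrix (Fin p) (Fin p) ℝ) :
    EuclideanSpace ℝ (Fin p) →L[ℝ] EuclideanSpace ℝ (Fin p) :=
  Matrix.toEuclideanCLM (𝕜 := ℝ) (CFC.sqrt Γ)⁻¹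

/-- The normalizing constant of the Gaussian density with covariance `Γ`. -/
def gaussianConst (Γ : Matrix (Fin p) (Fin p) ℝ) : ℝ :=
  (√((2 * Real.pi) ^ p * Γ.det))⁻¹

lemma gaussianConst_pos (hΓ : Γ.PosDef) : 0 < gaussianConst Γ := by
  have := hΓ.det_pos
  unfold gaussianConst; positivity

/-- `Γ^{1/2}` inverts the whitening map, so decay in the whitened norm gives decay in the Euclidean
norm. -/
lemma norm_le_mul_norm_whitening (hΓ : Γ.PosDef) (v : EuclideanSpace ℝ (Fin p)) :
    ‖v‖ ≤ ‖Matrix.toEuclideanCLM (𝕜 := ℝ) (CFC.sqrt Γ)‖ * ‖whitening Γ v‖ := by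
  have hu : IsUnit (CFC.sqrt Γ) :=
    (CFC.isUnit_sqrt_iff Γ hΓ.isStrictlyPositive.nonneg).2 hΓ.isUnit
  have hinv : Matrix.toEuclideanCLM (𝕜 := ℝ) (CFC.sqrt Γ) (whitening Γ v) = v := by
    rw [whitening, ← mul_apply_eq_comp, ← map_mul,
      Matrix.mul_nonsing_inv _ ((Matrix.isUnit_iff_isUnit_det _).1 hu), map_one]
    rfl
  calc ‖v‖ = ‖Matrix.toEuclideanCLM (𝕜 := ℝ) (CFC.sqrt Γ) (whitening Γ v)‖ := by rw [hinv]
    _ ≤ _ := ContinuousLinearMap.le_opNorm _ _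

lemma integrable_exp_neg_mul_sq_norm_whitening (hΓ : Γ.PosDef) {b : ℝ} (hb : 0 < b) :
    Integrable fun v : EuclideanSpace ℝ (Fin p) => Real.exp (-b * ‖whitening Γ v‖ ^ 2) := by
  set K := ‖Matrix.toEuclideanCLM (𝕜 := ℝ) (CFC.sqrt Γ)‖
  -- The `+ 1` avoids a zero denominator: `K = 0` when `p = 0`.
  set a := b / (K ^ 2 + 1) with ha
  have ha0 : 0 < a := by positivity
  have hint : Integrable fun v : EuclideanSpace ℝ (Fin p) => Real.exp (-a * ‖v‖ ^ 2) := by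
    have := (GaussianFourier.integrable_cexp_neg_mul_sq_norm_add
      (V := EuclideanSpace ℝ (Fin p)) (b := (a : ℂ)) (by simpa using ha0) 0 0).norm
    refine this.congr (ae_of_all _ fun v => ?_)
    simp only [Complex.norm_exp]
    norm_cast
    simp
  refine hint.mono' (by fun_prop) (ae_of_all _ fun v => ?_)
  rw [Real.norm_of_nonneg (Real.exp_pos _).le, Real.exp_le_exp]
  have h1 : ‖v‖ ^ 2 ≤ (K * ‖whitening Γ v‖) ^ 2 := by
    gcongr; exact norm_le_mul_norm_whitening hΓ v
  have h2 : a * ‖v‖ ^ 2 ≤ b * ‖whitening Γ v‖ ^ 2 := by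
    rw [ha, div_mul_eq_mul_div, div_le_iff₀ (by positivity), mul_assoc]
    gcongr
    nlinarith [sq_nonneg ‖whitening Γ v‖]
  linarith

lemma integrable_gaussianKernel_whitening (hΓ : Γ.PosDef) :
    Integrable (gaussianKernel (gaussianConst Γ) (whitening Γ)) :=
  (integrable_exp_neg_mul_sq_norm_whitening hΓ one_half_pos).const_mul _

lemma integrable_sq_mul_gaussianKernel_whitening (hΓ : Γ.PosDef) :
    Integrable fun v : EuclideanSpace ℝ (Fin p) =>
      ‖whitening Γ v‖ ^ 2 * gaussianKernel (gaussianConst Γ) (whitening Γ) v := by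
  have hc := gaussianConst_pos hΓ
  refine ((integrable_exp_neg_mul_sq_norm_whitening hΓ (b := 1 / 4) (by norm_num)).const_mul
    (4 * gaussianConst Γ)).mono'
    (((whitening Γ).continuous.norm.pow 2).mul continuous_gaussianKernel).aestronglyMeasurable
    (ae_of_all _ fun v => ?_)
  rw [Real.norm_of_nonneg (mul_nonneg (by positivity) (gaussianKernel_pos hc v).le)]
  exact sq_norm_mul_gaussianKernel_le_exp hc v

end GaussianIntegrability

end

end BayesOED

/-! ### The rate and the convergence of maximizers -/

theorem theorem4p1
    {X : Type*} [NormedAddCommGroup X] [NormedSpace ℝ X] [CompleteSpace X]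
    [TopologicalSpace.SeparableSpace X] [MeasurableSpace X] [BorelSpace X]
    (μ₀ : Measure X) [IsProbabilityMeasure μ₀]
    {D : Type*} [MetricSpace D]
    {p : ℕ} (Γ : Matrix (Fin p) (Fin p) ℝ) (hΓ : Γ.PosDef)
    (G : X → D → EuclideanSpace ℝ (Fin p)) (GN : ℕ → X → D → EuclideanSpace ℝ (Fin p))
    (hG_meas : ∀ d, Measurable fun x => G x d)
    (hGN_meas : ∀ N d, Measurable fun x => GN N x d)
    (C_G : ℝ)
    (hG : (⨆ d, ∫⁻ x, ENNReal.ofReal (BayesOED.weightedNorm Γ (G x d) ^ 4) ∂μ₀)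
      ≤ ENNReal.ofReal C_G)
    (hGN : ∀ N, (⨆ d, ∫⁻ x, ENNReal.ofReal (BayesOED.weightedNorm Γ (GN N x d) ^ 4) ∂μ₀)
      ≤ ENNReal.ofReal C_G)
    (ψ : ℕ → ℝ) (hψ_nonneg : ∀ N, 0 ≤ ψ N) (hψ : Tendsto ψ atTop (𝓝 0))
    (C₀ : ℝ)
    (hψ_bound : ∀ N d,
      ∫⁻ x, ENNReal.ofReal (BayesOED.weightedNorm Γ (G x d - GN N x d) ^ 2) ∂μ₀
        ≤ ENNReal.ofReal (C₀ * ψ N))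
    (hG_cont : ∀ x, Continuous fun d => G x d) :
    (∀ d, BayesOED.FiniteUtility μ₀ (BayesOED.likelihood Γ fun x => G x d)) ∧
    (∀ N d, BayesOED.FiniteUtility μ₀ (BayesOED.likelihood Γ fun x => GN N x d)) ∧
    (∃ C : ℝ, 0 < C ∧ ∀ᶠ N in atTop,
      BddAbove (Set.range fun d => |BayesOED.designUtility μ₀ Γ G d - BayesOED.designUtility μ₀ Γ (GN N) d|) ∧
      (⨆ d, |BayesOED.designUtility μ₀ Γ G d - BayesOED.designUtility μ₀ Γ (GN N) d|) ≤ C * √(ψ N)) ∧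
    (∀ dstar : ℕ → D, (∀ N, IsMaxOn (BayesOED.designUtility μ₀ Γ (GN N)) Set.univ (dstar N)) →
      ∀ φ : ℕ → ℕ, StrictMono φ → ∀ d : D, Tendsto (dstar ∘ φ) atTop (𝓝 d) →
        IsMaxOn (BayesOED.designUtility μ₀ Γ G) Set.univ d) := by
  -- By unfolding, `weightedNorm Γ v` is `‖L v‖` and `likelihood Γ g` is `kernelLikelihood
  -- (gaussianConst Γ) L g`, so the kernel lemmas apply directly.
  open BayesOED in
  set L := whitening Γ with hL
  have hc := gaussianConst_pos hΓ
  have hk := integrable_gaussianKernel_whitening hΓ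
  have hk2 := integrable_sq_mul_gaussianKernel_whitening hΓ
  have hmL {u : X → EuclideanSpace ℝ (Fin p)} (hu : Measurable u) :
      Measurable fun x => ‖L (u x)‖ := L.continuous.norm.measurable.comp hu
  have hG4 (d : D) := integrable_and_integral_le_of_lintegral_ofReal_le
    ((hmL (hG_meas d)).pow_const 4) (fun x => by positivity) ((iSup_le_iff.1 hG) d)
  have hGN4 (N : ℕ) (d : D) := integrable_and_integral_le_of_lintegral_ofReal_le
    ((hmL (hGN_meas N d)).pow_const 4) (fun x => by positivity) ((iSup_le_iff.1 (hGN N)) d)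
  have hG2 (d : D) := integrable_sq_of_integrable_pow_four (hmL (hG_meas d)) (hG4 d).1
  have hGN2 (N : ℕ) (d : D) :=
    integrable_sq_of_integrable_pow_four (hmL (hGN_meas N d)) (hGN4 N d).1
  have hdiff (N : ℕ) (d : D) := integrable_and_integral_le_of_lintegral_ofReal_le
    ((hmL ((hG_meas d).sub (hGN_meas N d))).pow_const 2) (fun x => by positivity) (hψ_bound N d)
  set A := (∫ v, gaussianKernel (gaussianConst Γ) L v)
    + ∫ v, ‖L v‖ ^ 2 * gaussianKernel (gaussianConst Γ) L v with hA
  have hA0 : 0 ≤ A := add_nonneg (integral_nonneg fun v => (gaussianKernel_pos hc v).le)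
    (integral_nonneg fun v => mul_nonneg (by positivity) (gaussianKernel_pos hc v).le)
  -- The `+ 1` makes the constant positive even if `C₀ ≤ 0`.
  set C := A * √(max C₀ 0) + 1 with hC
  have hC0 : 0 < C := by positivity
  have hbound : ∀ᶠ N in atTop, ∀ d,
      |designUtility μ₀ Γ G d - designUtility μ₀ Γ (GN N) d| ≤ C * √(ψ N) := by
    have hs : Tendsto (fun N => √(max C₀ 0) * √(ψ N)) atTop (𝓝 0) := by
      simpa using ((Real.continuous_sqrt.tendsto 0).comp hψ).const_mul (√(max C₀ 0))
    -- Here `s = √(max C₀ 0) * √(ψ N)`; the requirement `s ≤ 1` is why `N` must be large.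
    filter_upwards [hs.eventually_le_const one_pos] with N hN d
    have hle : ∫ x, ‖L (G x d - GN N x d)‖ ^ 2 ∂μ₀ ≤ (√(max C₀ 0) * √(ψ N)) ^ 2 := by
      refine (hdiff N d).2.trans ?_
      rw [mul_pow, Real.sq_sqrt (le_max_right _ _), Real.sq_sqrt (hψ_nonneg N)]
      exact max_le (mul_le_mul_of_nonneg_right (le_max_left _ _) (hψ_nonneg N))
        (mul_nonneg (le_max_right _ _) (hψ_nonneg N))
    have := abs_expectedUtility_sub_le hc hk hk2 (hG_meas d) (hGN_meas N d) (hG2 d) (hGN2 N d)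
      (hdiff N d).1 (by positivity) hN hle
    refine this.trans ?_
    rw [← hA, hC]
    nlinarith [Real.sqrt_nonneg (ψ N)]
  refine ⟨fun d => finiteUtility_kernelLikelihood hc hk hk2 (hG_meas d) (hG2 d),
    fun N d => finiteUtility_kernelLikelihood hc hk hk2 (hGN_meas N d) (hGN2 N d),
    ⟨C, hC0, ?_⟩, ?_⟩
  · filter_upwards [hbound] with N hN
    -- Nonnegativity of the bound covers empty `D`, where the real supremum is 0.
    exact ⟨⟨_, Set.forall_mem_range.2 hN⟩, Real.iSup_le hN (by positivity)⟩
  · intro dstar hmax φ hφ d hd d' _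
    have hU : Tendsto (fun n => designUtility μ₀ Γ G (dstar (φ n))) atTop
        (𝓝 (designUtility μ₀ Γ G d)) :=
      tendsto_expectedUtility_kernelLikelihood hc hk hk2 (fun n => hG_meas (dstar (φ n)))
        (hG_meas d) (fun n => (hG4 _).1) (hG4 d).1 (fun n => (hG4 _).2) (hG4 d).2
        fun x => ((hG_cont x).tendsto d).comp hd
    have he : Tendsto (fun n => 2 * (C * √(ψ (φ n)))) atTop (𝓝 0) := by
      simpa using ((((Real.continuous_sqrt.tendsto 0).comp hψ).comp
        hφ.tendsto_atTop).const_mul C).const_mul 2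
    have hsum := hU.add he
    rw [add_zero] at hsum
    -- With `e = C * √(ψ (φ n))` and `d_n = dstar (φ n)`: `U(d') ≤ U_N(d') + e ≤ U_N(d_n) + e ≤
    -- U(d_n) + 2e`, where `N = φ n`.
    refine ge_of_tendsto hsum ?_
    filter_upwards [hφ.tendsto_atTop.eventually hbound] with n hn
    have h1 := abs_le.1 (hn d')
    have h2 := abs_le.1 (hn (dstar (φ n)))
    have h3 : designUtility μ₀ Γ (GN (φ n)) d'
        ≤ designUtility μ₀ Γ (GN (φ n)) (dstar (φ n)) := hmax (φ n) (Set.mem_univ d')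
    linarith
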